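/- Let $T>0$ and let $y=\{y(u,t),\ u\in[0,1],\ t\in[0,T]\}$ be a random element of the Skorohod space $D([0,1],C[0,T])$ (right-continuous functions with left limits from $[0,1]$ to $C[0,T]$ with the uniform distance), defined on a probability space. Let $\mathcal F_t=\sigma(y(u,s),\ u\in[0,1],\ s\le t)$, $t\in[0,T]$, and $$m(u,t)=\mathrm{Leb}\{v\in[0,1]:\ \exists s\le t,\ y(v,s)=y(u,s)\},\qquad \tau_{u,v}=\inf\{t:\ y(u,t)=y(v,t)\}\wedge T .$$ Assume that ((C2)–(C5) being understood almost surely) * (C1$'$) for all $u\in[0,1]$, $y(u,\cdot)$ is a continuous $(\mathcal F_t)$-martingale; * (C2) for all $u\in[0,1]$, $y(u,0)=u$; * (C3) for all $u<v$ in $[0,1]$ and $t\in[0,T]$, $y(u,t)\le y(v,t)$; * (C4) for all $u\in[0,1]$ and $t\in[0,T]$, the quadratic variation is $\langle y(u,\cdot)\rangle_t=\int_0^t\frac{ds}{m(u,s)}$; * (C5) for all $u,v\in[0,1]$ and $t\in[0,T]$, $\langle y(u,\cdot),y(v,\cdot)\rangle_{t\wedge\tau_{u,v}}=0$. Then: 1.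 For every $\beta\in(0,\frac32)$ there is a constant $C$ such that $\mathbb E\, m(u,t)^{-\beta}\le \frac{C}{\sqrt t}$ for all $u\in[0,1]$ and $t\in(0,T]$. 2. There is a constant $C$ such that $\mathbb E\int_0^t\frac{ds}{m(u,s)}\le C\sqrt t$ for all $u\in[0,1]$ and $t\in[0,T]$. 3. There is a constant $C$ such that $\mathbb E\,(y(u,t)-u)^2\le C\sqrt t$ for all $u\in[0,1]$ and $t\in[0,T]$; moreover, for every $u\in[0,1]$, $y(u,\cdot)$ is a continuous square integrable $(\mathcal F_t)$-martingale. -/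

import Mathlib

open MeasureTheory ProbabilityTheory Set Filter
open scoped Topology unitInterval ENNReal

namespace HeavyFlow

/-- The time interval `[0, T]`. -/
abbrev Time (T : ℝ) : Type := Set.Icc (0 : ℝ) T

/-- Right-continuous functions with left limits on `[0, 1]`. At `u = 1` right continuity is void,
and at `u = 0` the existence of a left limit is void, because `𝓝[<] 0 = ⊥` in `I = [0, 1]`. -/
def IsCadlag {E : Type*} [TopologicalSpace E] (f : I → E) : Prop :=
  ∀ u : I, ContinuousWithinAt f (Set.Ici u) u ∧ ∃ l : E, Tendsto f (𝓝[<] u) (𝓝 l)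

/-- The Skorohod space `D([0, 1], C[0, T])`, where `C[0, T]` carries the uniform topology. -/
def SkorohodSpace (T : ℝ) : Type :=
  {f : I → C(Time T, ℝ) // IsCadlag f}

instance (T : ℝ) : CoeFun (SkorohodSpace T) (fun _ => I → C(Time T, ℝ)) :=
  ⟨fun f => f.1⟩

/-- The σ-algebra on `D([0, 1], C[0, T])` generated by the evaluations `f ↦ f(u, t)`. Since
`C[0, T]` is a separable metric space whose Borel σ-algebra is generated by the evaluations, this
is the Borel σ-algebra of the Skorohod topology, so that a random element of `D([0, 1], C[0, T])`
is a map which is measurable for it. -/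
instance (T : ℝ) : MeasurableSpace (SkorohodSpace T) :=
  ⨆ (u : I) (t : Time T), MeasurableSpace.comap (fun f : SkorohodSpace T => f u t) inferInstance

lemma measurable_eval {T : ℝ} (u : I) (t : Time T) :
    Measurable (fun f : SkorohodSpace T => f u t) := by
  rw [measurable_iff_comap_le]
  exact le_iSup₂_of_le (f := fun (u : I) (t : Time T) =>
    MeasurableSpace.comap (fun f : SkorohodSpace T => f u t) inferInstance) u t le_rfl

/-- `m(u, t) = Leb {v ∈ [0, 1] : ∃ s ≤ t, f(v, s) = f(u, s)}`, as an extended nonnegative number,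
so that `1 / m(u, t) = ∞` where `m(u, t) = 0`. -/
noncomputable def mass {T : ℝ} (f : SkorohodSpace T) (u : I) (t : Time T) : ℝ≥0∞ :=
  volume {v : I | ∃ s : Time T, s ≤ t ∧ f v s = f u s}

/-- Lebesgue measure on `[0, T]`. -/
noncomputable def lebesgueTime (T : ℝ) : Measure (Time T) :=
  Measure.comap Subtype.val volume

/-- `∫₀ᵗ ds / m(u, s)`, with value in `[0, ∞]`. -/
noncomputable def inverseMassIntegral {T : ℝ} (f : SkorohodSpace T) (u : I) (t : Time T) : ℝ≥0∞ :=
  ∫⁻ s in Set.Iic t, (mass f u s)⁻¹ ∂lebesgueTime T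

lemma sInf_meeting_mem {T : ℝ} [hT : Fact (0 ≤ T)] (S : Set (Time T)) :
    sInf (insert T ((fun t : Time T => (t : ℝ)) '' S)) ∈ Set.Icc (0 : ℝ) T := by
  have h0 : ∀ b ∈ insert T ((fun t : Time T => (t : ℝ)) '' S), (0 : ℝ) ≤ b := by
    rintro b (rfl | ⟨t, -, rfl⟩)
    · exact hT.out
    · exact t.2.1
  exact ⟨le_csInf ⟨T, mem_insert _ _⟩ h0, csInf_le ⟨0, h0⟩ (mem_insert _ _)⟩

/-- `inf {t : f(u, t) = f(v, t)} ∧ T`. -/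
noncomputable def meetingTime {T : ℝ} [Fact (0 ≤ T)] (f : SkorohodSpace T) (u v : I) : Time T :=
  ⟨sInf (insert T ((fun t : Time T => (t : ℝ)) '' {t : Time T | f u t = f v t})),
    sInf_meeting_mem _⟩

section Probability

variable {Ω : Type*} {mΩ : MeasurableSpace Ω}

/-- The filtration `ℱ_t = σ(y(u, s), u ∈ [0, 1], s ≤ t)`, `t ∈ [0, T]`. -/
def flowFiltration {T : ℝ} (y : Ω → SkorohodSpace T) (hy : Measurable y) :
    Filtration (Time T) mΩ where
  seq t := ⨆ (u : I) (s : Time T) (_ : s ≤ t),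
    MeasurableSpace.comap (fun ω => y ω u s) inferInstance
  mono' _ _ hst := iSup_mono fun _ => iSup_mono fun _ => iSup_mono' fun h => ⟨h.trans hst, le_rfl⟩
  le' _ := iSup_le fun u => iSup_le fun s => iSup_le fun _ =>
    measurable_iff_comap_le.mp ((measurable_eval u s).comp hy)

/-- The completion of a filtration: the events that differ by a `P`-null set from an event of
`ℱ_t`. -/
def completion {ι : Type*} [Preorder ι] (ℱ : Filtration ι mΩ) (P : Measure Ω) :
    Filtration ι mΩ where
  seq t := eventuallyMeasurableSpace (ℱ t) (ae P) ⊓ mΩ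
  mono' _ _ hst := inf_le_inf_right _ fun _ ⟨A, hA, h⟩ => ⟨A, ℱ.mono hst _ hA, h⟩
  le' _ := inf_le_right

/-- Local martingales. On the compact time interval `[0, T]` a localizing sequence of stopping times
(with values in `[0, T] ∪ {⊤}`) is almost surely eventually equal to `⊤`. -/
def IsLocalMartingale {T : ℝ} [Fact (0 ≤ T)] (X : Time T → Ω → ℝ) (ℱ : Filtration (Time T) mΩ)
    (P : Measure Ω) : Prop :=
  Locally (fun Z => Martingale Z ℱ P) ℱ X P

/-- `V` is (a version of) the joint quadratic variation `⟨M, N⟩` of the processes `M` and `N`: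
the adapted continuous process of bounded variation started from `0` for which `M N - V` is a
local martingale. -/
structure IsQuadraticCovariation {T : ℝ} [Fact (0 ≤ T)] (M N V : Time T → Ω → ℝ)
    (ℱ : Filtration (Time T) mΩ) (P : Measure Ω) : Prop where
  adapted : StronglyAdapted ℱ V
  zero : ∀ᵐ ω ∂P, V ⊥ ω = 0
  continuous : ∀ᵐ ω ∂P, Continuous fun t => V t ω
  boundedVariation : ∀ᵐ ω ∂P, BoundedVariationOn (fun t => V t ω) Set.univ
  isLocalMartingale : IsLocalMartingale (fun t ω => M t ω * N t ω - V t ω) ℱ P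

/-- Continuous martingales. -/
structure IsContinuousMartingale {T : ℝ} (X : Time T → Ω → ℝ) (ℱ : Filtration (Time T) mΩ)
    (P : Measure Ω) : Prop where
  continuous : ∀ ω, Continuous fun t => X t ω
  martingale : Martingale X ℱ P

/-- Continuous square integrable martingales. -/
structure IsContinuousSqIntegrableMartingale {T : ℝ} (X : Time T → Ω → ℝ)
    (ℱ : Filtration (Time T) mΩ) (P : Measure Ω) : Prop extends
    IsContinuousMartingale X ℱ P where
  memLp : ∀ t, MemLp (X t) 2 P

/-- A random element `y` of `D([0, 1], C[0, T])` which is a coalescing flow of martingales whose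
diffusion rates are inversely proportional to the masses. -/
structure IsFlow {T : ℝ} [Fact (0 ≤ T)] (y : Ω → SkorohodSpace T) (P : Measure Ω) : Prop where
  measurable : Measurable y
  /-- Every `y(u, ·)` is a continuous `(ℱ_t)`-martingale. -/
  martingale : ∀ u : I,
    IsContinuousMartingale (fun t ω => y ω u t) (flowFiltration y measurable) P
  /-- `y(u, 0) = u`. -/
  initial : ∀ᵐ ω ∂P, ∀ u : I, y ω u ⊥ = u
  /-- `y(u, t) ≤ y(v, t)` for `u < v`. -/
  monotone : ∀ᵐ ω ∂P, ∀ u v : I, u < v → ∀ t : Time T, y ω u t ≤ y ω v t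
  /-- `⟨y(u, ·)⟩_t = ∫₀ᵗ ds / m(u, s)`. -/
  quadraticVariation : ∀ u : I, ∃ V : Time T → Ω → ℝ,
    IsQuadraticCovariation (fun t ω => y ω u t) (fun t ω => y ω u t) V
      (completion (flowFiltration y measurable) P) P ∧
    ∀ᵐ ω ∂P, ∀ t : Time T, ENNReal.ofReal (V t ω) = inverseMassIntegral (y ω) u t
  /-- `⟨y(u, ·), y(v, ·)⟩_{t ∧ τ_{u,v}} = 0`. -/
  quadraticCovariation : ∀ u v : I, ∃ V : Time T → Ω → ℝ,
    IsQuadraticCovariation (fun t ω => y ω u t) (fun t ω => y ω v t) V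
      (completion (flowFiltration y measurable) P) P ∧
    ∀ᵐ ω ∂P, ∀ t : Time T, V (min t (meetingTime (y ω) u v)) ω = 0

end Probability

end HeavyFlow

/-! The key estimate is `IsFlow.measure_mass_lt_le`: P(m(u,t) < r) ≤ 2 r^{3/2} / √t for r ≤ 1/2.
Pick a particle that starts at distance r from u. If the two have met by time t, then by
monotonicity all particles between them belong to the cluster of u, and the mass is at least r. So a
mass below r means that they have not met, while m ≤ r up to time t forces the quadratic variation
of y(u,·) to be at least t/r.

Both at once are unlikely (`IsFlow.measure_not_meeting_le`). The gap G is a nonnegative martingale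
started at r, so it reaches a level K with probability at most r/K. Before it leaves (0,K), the two
particles have zero covariation, and E⟨G⟩ = E G² - r² ≤ K E G = K r. By Markov's inequality the
probability is at most r/K + K r²/t, and K = √(t/r) is optimal.

Summing the estimate over the levels r = 2^{-k} gives the negative moments of order β < 3/2. The
case β = 1, summed over dyadic times, bounds the expected quadratic variation by a multiple of √t.
Localization and Fatou's lemma carry this bound over to the variance. -/

namespace HeavyFlow

/-! ### Optional stopping on [0, T] and completed filtrations. -/

section OptionalStopping

variable {Ω : Type*} {mΩ : MeasurableSpace Ω}

/-- Stopping times with values in `[0, T]`. -/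
def IsStopping {T : ℝ} (ℱ : Filtration (Time T) mΩ) (ρ : Ω → Time T) : Prop :=
  ∀ s, MeasurableSet[ℱ s] {ω | ρ ω ≤ s}

lemma IsStopping.isStoppingTime {T : ℝ} {ℱ : Filtration (Time T) mΩ} {ρ : Ω → Time T}
    (h : IsStopping ℱ ρ) : IsStoppingTime ℱ (fun ω => (ρ ω : WithTop (Time T))) := by
  intro s
  simpa using h s

lemma isStopping_const {T : ℝ} (ℱ : Filtration (Time T) mΩ) (t : Time T) :
    IsStopping ℱ (fun _ => t) := by
  intro s
  simp

lemma IsStopping.min {T : ℝ} {ℱ : Filtration (Time T) mΩ} {ρ κ : Ω → Time T}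
    (hρ : IsStopping ℱ ρ) (hκ : IsStopping ℱ κ) : IsStopping ℱ (fun ω => min (ρ ω) (κ ω)) := by
  intro s
  simp only [min_le_iff]
  exact (hρ s).union (hκ s)

/-- The minimum of a stopping time in `[0, T]` and a stopping time in `[0, T] ∪ {⊤}`. -/
noncomputable def capTime {T : ℝ} (ρ : Ω → Time T) (τ : Ω → WithTop (Time T)) (ω : Ω) : Time T :=
  min (ρ ω) ((τ ω).untopD (ρ ω))

lemma coe_capTime {T : ℝ} (ρ : Ω → Time T) (τ : Ω → WithTop (Time T)) (ω : Ω) :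
    ((capTime ρ τ ω : Time T) : WithTop (Time T)) = min (ρ ω : WithTop (Time T)) (τ ω) := by
  unfold capTime
  induction τ ω <;> simp

lemma isStopping_capTime {T : ℝ} {ℱ : Filtration (Time T) mΩ} {ρ : Ω → Time T}
    {τ : Ω → WithTop (Time T)} (hρ : IsStopping ℱ ρ) (hτ : IsStoppingTime ℱ τ) :
    IsStopping ℱ (capTime ρ τ) := by
  intro s
  have : {ω | capTime ρ τ ω ≤ s} = {ω | ρ ω ≤ s} ∪ {ω | τ ω ≤ s} := by
    ext ω
    simp only [mem_ofPred_eq, mem_union]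
    rw [← WithTop.coe_le_coe, coe_capTime, min_le_iff, WithTop.coe_le_coe]
  rw [this]
  exact (hρ s).union (hτ s)

lemma capTime_le_left {T : ℝ} (ρ : Ω → Time T) (τ : Ω → WithTop (Time T)) (ω : Ω) :
    capTime ρ τ ω ≤ ρ ω := min_le_left _ _

lemma capTime_le_right {T : ℝ} (ρ : Ω → Time T) (τ : Ω → WithTop (Time T)) (ω : Ω) :
    (capTime ρ τ ω : WithTop (Time T)) ≤ τ ω := by
  rw [coe_capTime]; exact min_le_right _ _

lemma capTime_of_top {T : ℝ} (ρ : Ω → Time T) (τ : Ω → WithTop (Time T)) {ω : Ω} (h : τ ω = ⊤) :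
    capTime ρ τ ω = ρ ω := by
  simp [capTime, h]

/-- The first point `j / (k + 1)` not before `r`, cut off at `T`. -/
noncomputable def gridTime {T : ℝ} [hT : Fact (0 ≤ T)] (k : ℕ) (r : Time T) : Time T :=
  ⟨min ((⌈(k + 1 : ℝ) * (r : ℝ)⌉₊ : ℝ) / (k + 1)) T,
    le_min (by positivity) hT.out, min_le_right _ _⟩

/-- Before T the cut-off plays no role, and the rounding up of `r` becomes a rounding down of `s`.
Thus the rounded time of a stopping time is again a stopping time. -/
lemma gridTime_le_iff {T : ℝ} [hT : Fact (0 ≤ T)] (k : ℕ) (r s : Time T) (hs : (s : ℝ) < T) :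
    gridTime k r ≤ s ↔ (r : ℝ) ≤ (⌊(k + 1 : ℝ) * (s : ℝ)⌋₊ : ℝ) / (k + 1) := by
  have hk : (0 : ℝ) < k + 1 := by positivity
  have h0 : (0 : ℝ) ≤ (k + 1) * (s : ℝ) := mul_nonneg hk.le s.2.1
  rw [← Subtype.coe_le_coe, gridTime]
  simp only [min_le_iff, not_le.mpr hs, or_false]
  rw [div_le_iff₀ hk, mul_comm (s : ℝ), ← Nat.le_floor_iff h0, Nat.ceil_le, le_div_iff₀ hk,
    mul_comm]

lemma IsStopping.gridTime {T : ℝ} [hT : Fact (0 ≤ T)] {ℱ : Filtration (Time T) mΩ}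
    {ρ : Ω → Time T} (hρ : IsStopping ℱ ρ) (k : ℕ) :
    IsStopping ℱ (fun ω => gridTime k (ρ ω)) := by
  intro s
  rcases eq_or_lt_of_le s.2.2 with hs | hs
  · have : {ω | HeavyFlow.gridTime k (ρ ω) ≤ s} = univ := by
      ext ω
      simp only [mem_ofPred_eq, mem_univ, iff_true, ← Subtype.coe_le_coe, hs]
      exact (HeavyFlow.gridTime k (ρ ω)).2.2
    rw [this]
    exact MeasurableSet.univ
  · have hk : (0 : ℝ) < k + 1 := by positivity
    have h0 : (0 : ℝ) ≤ (k + 1) * (s : ℝ) := mul_nonneg hk.le s.2.1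
    have h1 : (⌊(k + 1 : ℝ) * (s : ℝ)⌋₊ : ℝ) / (k + 1) ≤ s := by
      rw [div_le_iff₀ hk]
      exact (Nat.floor_le h0).trans_eq (mul_comm _ _)
    let s' : Time T := ⟨(⌊(k + 1 : ℝ) * (s : ℝ)⌋₊ : ℝ) / (k + 1), by positivity, h1.trans s.2.2⟩
    have : {ω | HeavyFlow.gridTime k (ρ ω) ≤ s} = {ω | ρ ω ≤ s'} := by
      ext ω
      exact gridTime_le_iff k (ρ ω) s hs
    rw [this]
    exact ℱ.mono (show s' ≤ s from h1) _ (hρ s')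

lemma tendsto_gridTime {T : ℝ} [hT : Fact (0 ≤ T)] (r : Time T) :
    Tendsto (fun k => gridTime k r) atTop (𝓝 r) := by
  rw [tendsto_subtype_rng]
  have h1 : Tendsto (fun k : ℕ => (r : ℝ) + 1 / ((k : ℝ) + 1)) atTop (𝓝 (r : ℝ)) := by
    simpa using tendsto_const_nhds.add (tendsto_one_div_add_atTop_nhds_zero_nat (𝕜 := ℝ))
  refine tendsto_of_tendsto_of_tendsto_of_le_of_le tendsto_const_nhds h1 ?_ ?_
  · intro k
    have hk : (0 : ℝ) < k + 1 := by positivity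
    refine le_min ?_ r.2.2
    rw [le_div_iff₀ hk, mul_comm]
    exact Nat.le_ceil _
  · intro k
    have hk : (0 : ℝ) < k + 1 := by positivity
    refine (min_le_left _ _).trans ?_
    rw [div_le_iff₀ hk]
    have := Nat.ceil_lt_add_one (mul_nonneg hk.le r.2.1)
    have h2 : ((r : ℝ) + 1 / (k + 1)) * (k + 1) = (k + 1) * r + 1 := by field_simp
    exact this.le.trans_eq h2.symm

lemma countable_range_gridTime {T : ℝ} [hT : Fact (0 ≤ T)] (k : ℕ) (ρ : Ω → Time T) :
    (Set.range fun ω => (gridTime k (ρ ω) : WithTop (Time T))).Countable := by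
  let g : ℕ → WithTop (Time T) := fun j => ((⟨min ((j : ℝ) / (k + 1)) T,
    le_min (by positivity) hT.out, min_le_right _ _⟩ : Time T) : WithTop (Time T))
  refine (Set.countable_range g).mono ?_
  rintro _ ⟨ω, rfl⟩
  exact ⟨⌈(k + 1 : ℝ) * (ρ ω : ℝ)⌉₊, rfl⟩

/-- Optional stopping for martingales with continuous paths on `[0, T]`. -/
theorem integral_stopped_eq {T : ℝ} [hT : Fact (0 ≤ T)] {P : Measure Ω} [IsProbabilityMeasure P]
    {ℱ : Filtration (Time T) mΩ} {X : Time T → Ω → ℝ} (hX : Martingale X ℱ P)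
    (hc : ∀ᵐ ω ∂P, Continuous fun t => X t ω) {ρ : Ω → Time T} (hρ : IsStopping ℱ ρ) :
    Integrable (fun ω => X (ρ ω) ω) P ∧ ∫ ω, X (ρ ω) ω ∂P = ∫ ω, X ⊥ ω ∂P := by
  let m : ℕ → MeasurableSpace Ω := fun k => (hρ.gridTime k).isStoppingTime.measurableSpace
  have hm : ∀ k, m k ≤ mΩ := fun k => (hρ.gridTime k).isStoppingTime.measurableSpace_le
  have hae : ∀ k, (fun ω => X (gridTime k (ρ ω)) ω) =ᵐ[P] P[X ⊤ | m k] := fun k =>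
    hX.stoppedValue_ae_eq_condExp_of_le_const_of_countable_range
      (hρ.gridTime k).isStoppingTime (n := ⊤) (fun ω => by simp)
      (countable_range_gridTime k ρ)
  -- The stopped values along the grids are conditional expectations of one terminal value, hence
  -- uniformly integrable; path continuity gives their almost sure limit, and Vitali's theorem the
  -- limit of the integrals.
  have hUI : UniformIntegrable (fun k => P[X ⊤ | m k]) 1 P :=
    (hX.integrable ⊤).uniformIntegrable_condExp hm
  have hlim : ∀ᵐ ω ∂P, Tendsto (fun k => (P[X ⊤ | m k]) ω) atTop (𝓝 (X (ρ ω) ω)) := by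
    filter_upwards [hc, ae_all_iff.2 hae] with ω hω hk
    simp_rw [← hk]
    exact (hω.tendsto _).comp (tendsto_gridTime (ρ ω))
  have hmem : MemLp (fun ω => X (ρ ω) ω) 1 P := hUI.memLp_of_ae_tendsto hlim
  have hL1 := tendsto_Lp_finite_of_tendsto_ae le_rfl ENNReal.one_ne_top
    (fun k => hUI.1 k) hmem hUI.unifIntegrable hlim
  have hint := tendsto_integral_of_L1' _ hmem.aestronglyMeasurable
    (Eventually.of_forall fun k => integrable_condExp) hL1
  refine ⟨memLp_one_iff_integrable.1 hmem, tendsto_nhds_unique hint ?_⟩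
  have : ∀ k, ∫ ω, (P[X ⊤ | m k]) ω ∂P = ∫ ω, X ⊥ ω ∂P := by
    intro k
    rw [integral_condExp (hm k)]
    have := hX.setIntegral_eq (bot_le : (⊥ : Time T) ≤ ⊤) MeasurableSet.univ
    simpa using this.symm
  simp_rw [this]
  exact tendsto_const_nhds

lemma continuous_stoppedProcess {T : ℝ} [hT : Fact (0 ≤ T)] {X : Time T → Ω → ℝ}
    {τ : Ω → WithTop (Time T)} {ω : Ω} (h : Continuous fun t => X t ω) :
    Continuous fun t => stoppedProcess X τ t ω := by
  unfold stoppedProcess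
  rcases eq_or_ne (τ ω) ⊤ with h' | h'
  · simpa [h'] using h
  · lift τ ω to Time T using h' with c
    simp only [← WithTop.coe_min]
    exact h.comp (continuous_id.min continuous_const)

/-- Optional stopping for local martingales with continuous paths. -/
theorem integral_stopped_sub_eq_zero {T : ℝ} [hT : Fact (0 ≤ T)] {P : Measure Ω}
    [IsProbabilityMeasure P] {ℱ : Filtration (Time T) mΩ} {X : Time T → Ω → ℝ}
    (hc : ∀ᵐ ω ∂P, Continuous fun t => X t ω) {τ : Ω → WithTop (Time T)}
    (hX : Martingale (stoppedProcess (fun i ↦ {ω | ⊥ < τ ω}.indicator (X i)) τ) ℱ P)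
    {ρ : Ω → Time T} (hρ : IsStopping ℱ ρ) (hρτ : ∀ ω, (ρ ω : WithTop (Time T)) ≤ τ ω) :
    Integrable (fun ω => X (ρ ω) ω - X ⊥ ω) P ∧ ∫ ω, (X (ρ ω) ω - X ⊥ ω) ∂P = 0 := by
  set Y := stoppedProcess (fun i ↦ {ω | ⊥ < τ ω}.indicator (X i)) τ with hY
  have hYc : ∀ᵐ ω ∂P, Continuous fun t => Y t ω := by
    filter_upwards [hc] with ω hω
    refine continuous_stoppedProcess ?_
    by_cases h : ⊥ < τ ω
    · simpa [Set.indicator, h] using hω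
    · simpa [Set.indicator, h] using continuous_const
  obtain ⟨h1, h2⟩ := integral_stopped_eq hX hYc hρ
  have h3 : Integrable (Y ⊥) P := hX.integrable ⊥
  -- The indicator in the localization only matters where `τ ω = ⊥`; there `ρ ω = ⊥` and both
  -- increments vanish.
  have key : ∀ ω, Y (ρ ω) ω - Y ⊥ ω = X (ρ ω) ω - X ⊥ ω := by
    intro ω
    have hb : (min ((⊥ : Time T) : WithTop (Time T)) (τ ω)).untopA = ⊥ := by
      rw [min_eq_left (by simp)]; rfl
    have hr : (min (ρ ω : WithTop (Time T)) (τ ω)).untopA = ρ ω := by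
      rw [min_eq_left (hρτ ω)]; rfl
    simp only [hY, stoppedProcess, hb, hr]
    by_cases h : ⊥ < τ ω
    · simp [Set.indicator, h]
    · have h4 : (ρ ω : WithTop (Time T)) ≤ ⊥ := (hρτ ω).trans (not_lt.1 h)
      have h5 : ρ ω = ⊥ := by
        rw [← WithTop.coe_bot, WithTop.coe_le_coe] at h4
        exact le_bot_iff.1 h4
      simp [h5]
  simp_rw [← key]
  exact ⟨h1.sub h3, by rw [integral_sub h1 h3, h2, sub_self]⟩

/-- Since T is the largest time, the adjoined `⊤` is an isolated point. -/
lemma eventually_eq_top_of_tendsto {T : ℝ} [hT : Fact (0 ≤ T)] {τ : ℕ → WithTop (Time T)}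
    (h : Tendsto τ atTop (𝓝 ⊤)) : ∀ᶠ n in atTop, τ n = ⊤ := by
  have : ((⊤ : Time T) : WithTop (Time T)) < ⊤ := WithTop.coe_lt_top _
  filter_upwards [h.eventually_const_lt this] with n hn
  by_contra hne
  lift τ n to Time T using hne with c
  exact absurd (WithTop.coe_lt_coe.1 hn) (not_lt.2 le_top)

/-- A martingale remains a martingale for the completed filtration. -/
theorem martingale_completion {T : ℝ} {P : Measure Ω} [IsProbabilityMeasure P]
    {ℱ : Filtration (Time T) mΩ} {X : Time T → Ω → ℝ} (hX : Martingale X ℱ P) :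
    Martingale X (completion ℱ P) P := by
  have hle : ∀ t, ℱ t ≤ completion ℱ P t := fun t =>
    le_inf (fun A hA => ⟨A, hA, EventuallyEq.rfl⟩) (ℱ.le t)
  refine ⟨fun t => (hX.1 t).mono (hle t), fun s t hst => ?_⟩
  refine (ae_eq_condExp_of_forall_setIntegral_eq ((completion ℱ P).le s) (hX.integrable t)
    (fun _ _ _ => (hX.integrable s).integrableOn) ?_
    ((hX.1 s).mono (hle s)).aestronglyMeasurable).symm
  rintro A ⟨⟨B, hB, hAB⟩, -⟩ -
  rw [setIntegral_congr_set hAB, setIntegral_congr_set hAB]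
  exact hX.setIntegral_eq hst hB

end OptionalStopping

/-! ### Hitting times of continuous processes. -/

section HittingTime

/-- The infimum of a set of times, and `T` if the set is empty. -/
noncomputable def hitTime {T : ℝ} [Fact (0 ≤ T)] (S : Set (Time T)) : Time T :=
  ⟨sInf (insert T ((fun t : Time T => (t : ℝ)) '' S)), sInf_meeting_mem S⟩

variable {T : ℝ} [hT : Fact (0 ≤ T)] {S S' : Set (Time T)}

lemma bddBelow_insert_image (S : Set (Time T)) :
    BddBelow (insert T ((fun t : Time T => (t : ℝ)) '' S)) := by
  refine ⟨0, ?_⟩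
  rintro b (rfl | ⟨t, -, rfl⟩)
  · exact hT.out
  · exact t.2.1

lemma hitTime_le {t : Time T} (ht : t ∈ S) : hitTime S ≤ t :=
  Subtype.coe_le_coe.1 (csInf_le (bddBelow_insert_image S) (mem_insert_of_mem _ ⟨t, ht, rfl⟩))

lemma hitTime_anti (h : S ⊆ S') : hitTime S' ≤ hitTime S :=
  Subtype.coe_le_coe.1 (csInf_le_csInf (bddBelow_insert_image S') ⟨T, mem_insert _ _⟩
    (insert_subset_insert (image_mono h)))

/-- The infimum is attained, and a value below some `t ≤ T` cannot be the default value T. -/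
lemma hitTime_mem (hS : IsClosed S) {t : Time T} (h : hitTime S < t) : hitTime S ∈ S := by
  have hc : IsClosed (insert T ((fun t : Time T => (t : ℝ)) '' S)) :=
    isClosed_singleton.union ((isClosed_Icc.isClosedEmbedding_subtypeVal).isClosedMap S hS)
  rcases hc.csInf_mem ⟨T, mem_insert _ _⟩ (bddBelow_insert_image S) with h1 | ⟨r, hr, h1⟩
  · have h2 : (t : ℝ) ≤ T := t.2.2
    exact absurd (Subtype.coe_lt_coe.2 h) (not_lt.2 (h2.trans_eq h1.symm))
  · have : hitTime S = r := Subtype.ext h1.symm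
    rwa [this]

lemma hitTime_le_iff (hS : IsClosed S) {s t : Time T} (hst : s < t) :
    hitTime S ≤ s ↔ ∃ r ≤ s, r ∈ S :=
  ⟨fun h => ⟨_, h, hitTime_mem hS (h.trans_lt hst)⟩, fun ⟨_, hr, hrS⟩ => (hitTime_le hrS).trans hr⟩

/-- The existence of a time before `s` at which a continuous function is nonpositive, in terms of
countably many times. -/
lemma exists_nonpos_iff {f : Time T → ℝ} (hf : Continuous f) (s : Time T) :
    (∃ r ≤ s, f r ≤ 0) ↔
      ∀ n : ℕ, ∃ i, f (min (TopologicalSpace.denseSeq (Time T) i) s) < 1 / ((n : ℝ) + 1) := by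
  constructor
  · rintro ⟨r, hr, h0⟩ n
    -- Truncation by `min q s` turns the condition on [0, s] into an open condition on [0, T], so
    -- dense times suffice even if `r = s`.
    have hg : Continuous fun q : Time T => f (min q s) := hf.comp (continuous_id.min continuous_const)
    have ho : IsOpen {q : Time T | f (min q s) < 1 / ((n : ℝ) + 1)} :=
      isOpen_lt hg continuous_const
    obtain ⟨_, hq, i, rfl⟩ := (TopologicalSpace.denseRange_denseSeq (Time T)).inter_open_nonempty _ ho
      ⟨r, by
        simp only [mem_ofPred_eq, min_eq_left hr]
        exact h0.trans_lt (by positivity)⟩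
    exact ⟨i, hq⟩
  · intro h
    obtain ⟨r, hr, hmin⟩ := (isClosed_Iic (a := s)).isCompact.exists_isMinOn ⟨s, mem_Iic.2 le_rfl⟩
      hf.continuousOn
    refine ⟨r, hr, le_of_forall_pos_lt_add fun ε hε => ?_⟩
    obtain ⟨n, hn⟩ := exists_nat_one_div_lt hε
    obtain ⟨i, hi⟩ := h n
    have := hmin (show min (TopologicalSpace.denseSeq (Time T) i) s ∈ Iic s from
      mem_Iic.2 (min_le_right _ _))
    simp only [mem_ofPred_eq] at this
    linarith

lemma measurableSet_exists_nonpos {Ω : Type*} {m : MeasurableSpace Ω} {Z : Time T → Ω → ℝ}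
    (hc : ∀ ω, Continuous fun t => Z t ω) (s : Time T) (hZ : ∀ r ≤ s, Measurable (Z r)) :
    MeasurableSet {ω | ∃ r ≤ s, Z r ω ≤ 0} := by
  have : {ω | ∃ r ≤ s, Z r ω ≤ 0} = ⋂ n : ℕ, ⋃ i,
      {ω | Z (min (TopologicalSpace.denseSeq (Time T) i) s) ω < 1 / ((n : ℝ) + 1)} := by
    ext ω
    simp only [mem_ofPred_eq, mem_iInter, mem_iUnion]
    exact exists_nonpos_iff (hc ω) s
  rw [this]
  exact MeasurableSet.iInter fun n => MeasurableSet.iUnion fun i =>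
    measurableSet_lt (hZ _ (min_le_right _ _)) measurable_const

/-- The first time at which an adapted continuous process is nonpositive is a stopping time. -/
lemma isStopping_hitTime {Ω : Type*} {mΩ : MeasurableSpace Ω} {ℱ : Filtration (Time T) mΩ}
    {Z : Time T → Ω → ℝ} (hc : ∀ ω, Continuous fun t => Z t ω) (hZ : StronglyAdapted ℱ Z) :
    IsStopping ℱ (fun ω => hitTime {t | Z t ω ≤ 0}) := by
  intro s
  -- At T the event is everything, whether or not the set is hit, so `hitTime_le_iff` is needed only
  -- before T.
  rcases eq_or_lt_of_le (le_top : s ≤ ⊤) with rfl | hs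
  · simp
  · simp_rw [hitTime_le_iff (isClosed_le (hc _) continuous_const) hs, mem_ofPred_eq]
    exact measurableSet_exists_nonpos hc s fun r hr => ((hZ r).mono (ℱ.mono hr)).measurable

/-- Before the first time at which it reaches a level, a continuous function stays below it. -/
lemma le_of_le_hitTime {f : Time T → ℝ} (hf : Continuous f) {K : ℝ} (h0 : f ⊥ ≤ K) {r : Time T}
    (hS : ∀ t, f t = K → t ∈ S) (hr : r ≤ hitTime S) : f r ≤ K := by
  by_contra! hK
  have hg : Continuous fun x : ℝ => f (projIcc 0 T hT.out x) := hf.comp continuous_projIcc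
  obtain ⟨x, hx, hxK⟩ := intermediate_value_Icc r.2.1 hg.continuousOn
    (show K ∈ Icc (f (projIcc 0 T hT.out 0)) (f (projIcc 0 T hT.out (r : ℝ))) by
      rw [projIcc_val, projIcc_left]
      exact ⟨h0, hK.le⟩)
  have hxT : x ∈ Icc 0 T := ⟨hx.1, hx.2.trans r.2.2⟩
  simp only [projIcc_of_mem hT.out hxT] at hxK
  have h1 : r ≤ ⟨x, hxT⟩ := hr.trans (hitTime_le (hS _ hxK))
  have h2 : r = ⟨x, hxT⟩ := le_antisymm h1 hx.2
  rw [← h2] at hxK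
  exact absurd hxK hK.ne'

end HittingTime

/-- The event is almost surely contained in the lower limit of the `S n`. This removes the
localization from probability bounds that are uniform in `n`. -/
lemma measure_le_of_eventually_mem {Ω : Type*} {mΩ : MeasurableSpace Ω} {P : Measure Ω}
    {E : Set Ω} {S : ℕ → Set Ω} {c : ℝ≥0∞}
    (hE : ∀ᵐ ω ∂P, ω ∈ E → ∀ᶠ n in atTop, ω ∈ S n) (hS : ∀ n, P (S n) ≤ c) : P E ≤ c := by
  have h1 : P E ≤ P (⋃ N, ⋂ n ≥ N, S n) := by
    refine measure_mono_ae ?_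
    filter_upwards [hE] with ω hω h
    obtain ⟨N, hN⟩ := eventually_atTop.1 (hω h)
    exact mem_iUnion.2 ⟨N, mem_iInter₂.2 hN⟩
  refine h1.trans ?_
  have hmono : Monotone fun N => ⋂ n ≥ N, S n := fun M N h =>
    biInter_mono (fun n hn => h.trans hn) fun _ _ => le_rfl
  rw [hmono.measure_iUnion]
  exact iSup_le fun N => (measure_mono (iInter₂_subset N le_rfl)).trans (hS N)

/-! ### Pathwise properties of the integral of the inverse mass. -/

lemma inverseMassIntegral_mono {T : ℝ} (f : SkorohodSpace T) (u : I) :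
    Monotone (inverseMassIntegral f u) :=
  fun _ _ h => lintegral_mono_set (Iic_subset_Iic.2 h)

lemma lebesgueTime_Iic {T : ℝ} (t : Time T) :
    lebesgueTime T (Iic t) = ENNReal.ofReal t := by
  rw [lebesgueTime, (MeasurableEmbedding.subtype_coe measurableSet_Icc).comap_apply]
  have : Subtype.val '' (Iic t : Set (Time T)) = Icc (0 : ℝ) t := by
    ext x
    constructor
    · rintro ⟨s, hs, rfl⟩
      exact ⟨s.2.1, hs⟩
    · intro hx
      exact ⟨⟨x, hx.1, hx.2.trans t.2.2⟩, hx.2, rfl⟩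
  rw [this, Real.volume_Icc, sub_zero]

/-- Clusters grow with time, so the mass is at most `r` on all of [0, t]. -/
lemma ofReal_le_inverseMassIntegral_of_mass_le {T : ℝ} {f : SkorohodSpace T} {u : I}
    {t : Time T} {r : ℝ} (hr : 0 < r) (h : mass f u t ≤ ENNReal.ofReal r) :
    ENNReal.ofReal ((t : ℝ) / r) ≤ inverseMassIntegral f u t := by
  calc ENNReal.ofReal ((t : ℝ) / r) = ∫⁻ _ in Iic t, (ENNReal.ofReal r)⁻¹ ∂lebesgueTime T := by
        rw [setLIntegral_const, lebesgueTime_Iic, ENNReal.ofReal_div_of_pos hr, div_eq_mul_inv, mul_comm]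
    _ ≤ inverseMassIntegral f u t := by
        refine setLIntegral_mono' measurableSet_Iic fun s hs => ENNReal.inv_le_inv.2 (le_trans ?_ h)
        exact measure_mono fun v ⟨r, hr, hv⟩ => ⟨r, hr.trans hs, hv⟩

/-- `ENNReal.ofReal` forgets negative values. The sign comes back from m ≤ 1, which makes the
integral at least t, hence positive for t > 0. -/
lemma quadraticVariation_nonneg_mono {T : ℝ} [Fact (0 ≤ T)] {V : Time T → ℝ}
    (h0 : V ⊥ = 0) {f : SkorohodSpace T} {u : I} (hV : ∀ t, ENNReal.ofReal (V t) = inverseMassIntegral f u t) :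
    (∀ t, 0 ≤ V t) ∧ Monotone V := by
  have h1 : ∀ t, 0 ≤ V t := by
    intro t
    rcases eq_or_lt_of_le (bot_le : ⊥ ≤ t) with rfl | ht
    · exact h0.ge
    · have ht' : (0 : ℝ) < t := ht
      have h2 := ofReal_le_inverseMassIntegral_of_mass_le (f := f) (u := u) (t := t) one_pos (by
        rw [ENNReal.ofReal_one]; exact prob_le_one)
      rw [← hV, div_one] at h2
      exact (ENNReal.ofReal_pos.1 ((ENNReal.ofReal_pos.2 ht').trans_le h2)).le
  refine ⟨h1, fun s t hst => ?_⟩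
  have := inverseMassIntegral_mono f u hst
  rwa [← hV, ← hV, ENNReal.ofReal_le_ofReal_iff (h1 t)] at this

/-! ### Optional stopping for particles and their products. -/

section Flow

variable {Ω : Type*} {mΩ : MeasurableSpace Ω} {T : ℝ} [hT : Fact (0 ≤ T)] {P : Measure Ω}
  [IsProbabilityMeasure P] {y : Ω → SkorohodSpace T}

lemma IsFlow.martingale_completion (hy : IsFlow y P) (u : I) :
    Martingale (fun t ω => y ω u t) (completion (flowFiltration y hy.measurable) P) P :=
  HeavyFlow.martingale_completion (hy.martingale u).martingale

lemma IsFlow.integral_stopped (hy : IsFlow y P) (u : I) {ρ : Ω → Time T}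
    (hρ : IsStopping (completion (flowFiltration y hy.measurable) P) ρ) :
    Integrable (fun ω => y ω u (ρ ω)) P ∧ ∫ ω, y ω u (ρ ω) ∂P = u := by
  obtain ⟨h1, h2⟩ := integral_stopped_eq (hy.martingale_completion u)
    (ae_of_all _ (hy.martingale u).continuous) hρ
  refine ⟨h1, h2.trans ?_⟩
  rw [integral_congr_ae (g := fun _ => (u : ℝ)) (hy.initial.mono fun ω h => h u)]
  simp

/-- The product of two particles stopped at a reducing time. -/
lemma IsFlow.exists_localizing (hy : IsFlow y P) (u v : I) {V : Time T → Ω → ℝ}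
    (hV : IsQuadraticCovariation (fun t ω => y ω u t) (fun t ω => y ω v t) V
      (completion (flowFiltration y hy.measurable) P) P) :
    ∃ τ : ℕ → Ω → WithTop (Time T),
      (∀ n, IsStoppingTime (completion (flowFiltration y hy.measurable) P) (τ n)) ∧
      (∀ᵐ ω ∂P, ∀ᶠ n in atTop, τ n ω = ⊤) ∧
      ∀ (n : ℕ) (ρ : Ω → Time T), IsStopping (completion (flowFiltration y hy.measurable) P) ρ →
        (∀ ω, (ρ ω : WithTop (Time T)) ≤ τ n ω) →
        Integrable (fun ω => y ω u (ρ ω) * y ω v (ρ ω) - V (ρ ω) ω) P ∧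
        ∫ ω, (y ω u (ρ ω) * y ω v (ρ ω) - V (ρ ω) ω) ∂P = u * v := by
  obtain ⟨τ, hτ, hm⟩ := hV.isLocalMartingale
  refine ⟨τ, hτ.isStoppingTime, hτ.tendsto_top.mono fun ω h => eventually_eq_top_of_tendsto h, ?_⟩
  intro n ρ hρ hle
  have hc : ∀ᵐ ω ∂P, Continuous fun t => y ω u t * y ω v t - V t ω := by
    filter_upwards [hV.continuous] with ω hω
    exact (((hy.martingale u).continuous ω).mul ((hy.martingale v).continuous ω)).sub hω
  obtain ⟨h1, h2⟩ := integral_stopped_sub_eq_zero hc (hm n) hρ hle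
  have h0 : (fun ω => y ω u (ρ ω) * y ω v (ρ ω) - V (ρ ω) ω) =ᵐ[P] fun ω =>
      (y ω u (ρ ω) * y ω v (ρ ω) - V (ρ ω) ω - (y ω u ⊥ * y ω v ⊥ - V ⊥ ω)) + (u : ℝ) * v := by
    filter_upwards [hy.initial, hV.zero] with ω h h'
    rw [h u, h v, show V ⊥ ω = 0 from h']
    ring
  refine ⟨(h1.add (integrable_const _)).congr h0.symm, ?_⟩
  rw [integral_congr_ae h0, integral_add h1 (integrable_const _), h2]
  simp

end Flow

/-! ### The gap between two particles. -/

section Flow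

variable {Ω : Type*} {mΩ : MeasurableSpace Ω} {T : ℝ} [hT : Fact (0 ≤ T)] {P : Measure Ω}
  [IsProbabilityMeasure P] {y : Ω → SkorohodSpace T}

/-- The exit time of `y(b, ·) - y(a, ·)` from `(0, K)`. -/
noncomputable def exitTime (y : Ω → SkorohodSpace T) (a b : I) (K : ℝ) (ω : Ω) : Time T :=
  hitTime {t | min (y ω b t - y ω a t) (K - (y ω b t - y ω a t)) ≤ 0}

lemma IsFlow.isStopping_exitTime (hy : IsFlow y P) (a b : I) (K : ℝ) :
    IsStopping (completion (flowFiltration y hy.measurable) P) (exitTime y a b K) := by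
  refine isStopping_hitTime (Z := fun t ω => min (y ω b t - y ω a t) (K - (y ω b t - y ω a t)))
    (fun ω => ?_) fun t => ?_
  · have h := ((hy.martingale b).continuous ω).sub ((hy.martingale a).continuous ω)
    exact h.min (continuous_const.sub h)
  · have h := ((hy.martingale_completion b).1 t).sub ((hy.martingale_completion a).1 t)
    exact (continuous_id.min (continuous_const.sub continuous_id)).comp_stronglyMeasurable h

/-- Hence the covariation of the two particles vanishes up to the exit time. -/
lemma exitTime_le_meetingTime (y : Ω → SkorohodSpace T) (a b : I) (K : ℝ) (ω : Ω) :
    exitTime y a b K ω ≤ meetingTime (y ω) a b := by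
  refine hitTime_anti (S := {t | y ω a t = y ω b t}) fun t ht => ?_
  exact (min_le_left _ _).trans (sub_nonpos.2 (show y ω a t = y ω b t from ht).ge)

lemma IsFlow.ae_mem_Icc_of_le_exitTime {P : Measure Ω} (hy : IsFlow y P) {a b : I} (hab : a < b) {K : ℝ}
    (hK : (b : ℝ) - a ≤ K) : ∀ᵐ ω ∂P, ∀ r ≤ exitTime y a b K ω,
      y ω b r - y ω a r ∈ Icc 0 K := by
  filter_upwards [hy.initial, hy.monotone] with ω h0 hm r hr
  refine ⟨sub_nonneg.2 (hm a b hab r), ?_⟩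
  refine le_of_le_hitTime (f := fun t => y ω b t - y ω a t)
    (((hy.martingale b).continuous ω).sub ((hy.martingale a).continuous ω)) ?_ ?_ hr
  · rw [h0 a, h0 b]
    exact hK
  · intro t ht
    exact (min_le_right _ _).trans (sub_nonpos.2 (show y ω b t - y ω a t = K from ht).ge)

lemma IsFlow.integral_gap (hy : IsFlow y P) (a b : I) {ρ : Ω → Time T}
    (hρ : IsStopping (completion (flowFiltration y hy.measurable) P) ρ) :
    Integrable (fun ω => y ω b (ρ ω) - y ω a (ρ ω)) P ∧
      ∫ ω, (y ω b (ρ ω) - y ω a (ρ ω)) ∂P = b - a := by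
  obtain ⟨ha, ha'⟩ := hy.integral_stopped a hρ
  obtain ⟨hb, hb'⟩ := hy.integral_stopped b hρ
  exact ⟨hb.sub ha, by rw [integral_sub hb ha, ha', hb']⟩

/-- The energy estimate: until the exit of the gap from `(0, K)`, the quadratic variation of the
gap has expectation at most `K` times the initial gap. -/
lemma IsFlow.integral_quadraticVariation_le (hy : IsFlow y P) {a b : I} (hab : a < b) {K : ℝ}
    (hK : (b : ℝ) - a ≤ K) {Va Vb Vab : Time T → Ω → ℝ} {ρ : Ω → Time T}
    (hρ : IsStopping (completion (flowFiltration y hy.measurable) P) ρ)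
    (hle : ∀ ω, ρ ω ≤ exitTime y a b K ω)
    (hVab : ∀ᵐ ω ∂P, ∀ t : Time T, Vab (min t (meetingTime (y ω) a b)) ω = 0)
    (ha : Integrable (fun ω => y ω a (ρ ω) * y ω a (ρ ω) - Va (ρ ω) ω) P ∧
        ∫ ω, (y ω a (ρ ω) * y ω a (ρ ω) - Va (ρ ω) ω) ∂P = a * a)
    (hb : Integrable (fun ω => y ω b (ρ ω) * y ω b (ρ ω) - Vb (ρ ω) ω) P ∧
        ∫ ω, (y ω b (ρ ω) * y ω b (ρ ω) - Vb (ρ ω) ω) ∂P = b * b)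
    (hc : Integrable (fun ω => y ω a (ρ ω) * y ω b (ρ ω) - Vab (ρ ω) ω) P ∧
        ∫ ω, (y ω a (ρ ω) * y ω b (ρ ω) - Vab (ρ ω) ω) ∂P = a * b) :
    Integrable (fun ω => Va (ρ ω) ω + Vb (ρ ω) ω) P ∧
      ∫ ω, (Va (ρ ω) ω + Vb (ρ ω) ω) ∂P ≤ K * (b - a) := by
  obtain ⟨hg, hg'⟩ := hy.integral_gap a b hρ
  have hgap : ∀ᵐ ω ∂P, y ω b (ρ ω) - y ω a (ρ ω) ∈ Icc 0 K :=
    (hy.ae_mem_Icc_of_le_exitTime hab hK).mono fun ω h => h _ (hle ω)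
  have hsq : Integrable (fun ω => (y ω b (ρ ω) - y ω a (ρ ω)) ^ 2) P := by
    refine (hg.const_mul K).mono' (hg.aestronglyMeasurable.pow 2) ?_
    filter_upwards [hgap] with ω h
    rw [Real.norm_of_nonneg (sq_nonneg _), sq]
    exact mul_le_mul_of_nonneg_right h.2 h.1
  -- The gap G lies in [0, K], so G² ≤ K G, and G keeps its initial mean.
  have hsq' : ∫ ω, (y ω b (ρ ω) - y ω a (ρ ω)) ^ 2 ∂P ≤ K * (b - a) := by
    rw [← hg', ← integral_const_mul]
    refine integral_mono_ae hsq (hg.const_mul K) ?_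
    filter_upwards [hgap] with ω h
    rw [sq]
    exact mul_le_mul_of_nonneg_right h.2 h.1
  have hab1 : Integrable (fun ω => (y ω a (ρ ω) * y ω a (ρ ω) - Va (ρ ω) ω) +
      (y ω b (ρ ω) * y ω b (ρ ω) - Vb (ρ ω) ω)) P := ha.1.add hb.1
  have hc1 : Integrable (fun ω => 2 * (y ω a (ρ ω) * y ω b (ρ ω) - Vab (ρ ω) ω)) P :=
    hc.1.const_mul 2
  have hL : Integrable (fun ω => (y ω a (ρ ω) * y ω a (ρ ω) - Va (ρ ω) ω) +
      (y ω b (ρ ω) * y ω b (ρ ω) - Vb (ρ ω) ω) -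
      2 * (y ω a (ρ ω) * y ω b (ρ ω) - Vab (ρ ω) ω)) P := hab1.sub hc1
  -- Here `Vab` is zero, so G² minus `Va + Vb` is a combination of the compensated products, with
  -- integral a² + b² - 2ab = (b - a)² ≥ 0, which is dropped at the end.
  have heq : (fun ω => Va (ρ ω) ω + Vb (ρ ω) ω) =ᵐ[P] fun ω =>
      (y ω b (ρ ω) - y ω a (ρ ω)) ^ 2 - ((y ω a (ρ ω) * y ω a (ρ ω) - Va (ρ ω) ω) +
        (y ω b (ρ ω) * y ω b (ρ ω) - Vb (ρ ω) ω) -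
        2 * (y ω a (ρ ω) * y ω b (ρ ω) - Vab (ρ ω) ω)) := by
    filter_upwards [hVab] with ω h
    have h1 := h (ρ ω)
    rw [min_eq_left ((hle ω).trans (exitTime_le_meetingTime y a b K ω))] at h1
    rw [h1]
    ring
  refine ⟨(hsq.sub hL).congr heq.symm, ?_⟩
  rw [integral_congr_ae heq, integral_sub hsq hL, integral_sub hab1 hc1,
    integral_add ha.1 hb.1, integral_const_mul, ha.2, hb.2, hc.2]
  linarith [sq_nonneg ((b : ℝ) - a)]

/-- Two particles which have not met are unlikely to have a large quadratic variation. -/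
theorem IsFlow.measure_not_meeting_le (hy : IsFlow y P) {a b w : I} (hab : a < b)
    (hw : w = a ∨ w = b) (t : Time T) {A K : ℝ} (hA : 0 < A) (hK : 0 < K) :
    P {ω | (∀ s ≤ t, y ω a s ≠ y ω b s) ∧
        ENNReal.ofReal A ≤ inverseMassIntegral (y ω) w t} ≤
      ENNReal.ofReal ((b - a) / K + K * (b - a) / A) := by
  have hr : (0 : ℝ) < (b : ℝ) - a := sub_pos.2 hab
  -- If the gap starts above `K`, the asserted bound exceeds 1.
  rcases lt_or_ge K ((b : ℝ) - a) with hKr | hKr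
  · refine prob_le_one.trans ?_
    rw [← ENNReal.ofReal_one]
    refine ENNReal.ofReal_le_ofReal ?_
    have h1 : 1 ≤ ((b : ℝ) - a) / K := (one_le_div hK).2 hKr.le
    have h2 : 0 ≤ K * ((b : ℝ) - a) / A := by positivity
    linarith
  obtain ⟨Va, hVa, hVa'⟩ := hy.quadraticVariation a
  obtain ⟨Vb, hVb, hVb'⟩ := hy.quadraticVariation b
  obtain ⟨Vc, hVc, hVc'⟩ := hy.quadraticCovariation a b
  obtain ⟨τa, hτa, hta, hoa⟩ := hy.exists_localizing a a hVa
  obtain ⟨τb, hτb, htb, hob⟩ := hy.exists_localizing b b hVb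
  obtain ⟨τc, hτc, htc, hoc⟩ := hy.exists_localizing a b hVc
  have hσ : IsStopping (completion (flowFiltration y hy.measurable) P)
      (fun ω => min (exitTime y a b K ω) t) :=
    (hy.isStopping_exitTime a b K).min (isStopping_const _ t)
  let ρ : ℕ → Ω → Time T := fun n =>
    capTime (fun ω => min (exitTime y a b K ω) t) (fun ω => min (min (τa n ω) (τb n ω)) (τc n ω))
  have hρ : ∀ n, IsStopping (completion (flowFiltration y hy.measurable) P) (ρ n) := fun n =>
    isStopping_capTime hσ (((hτa n).min (hτb n)).min (hτc n))
  have hρτ : ∀ n ω, (ρ n ω : WithTop (Time T)) ≤ min (min (τa n ω) (τb n ω)) (τc n ω) :=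
    fun n ω => capTime_le_right _ _ ω
  have hρσ : ∀ n ω, ρ n ω ≤ exitTime y a b K ω := fun n ω =>
    (capTime_le_left _ _ ω).trans (min_le_left _ _)
  have hW := fun n => hy.integral_quadraticVariation_le hab hKr (hρ n) (hρσ n) hVc'
    (hoa n _ (hρ n) fun ω => (hρτ n ω).trans ((min_le_left _ _).trans (min_le_left _ _)))
    (hob n _ (hρ n) fun ω => (hρτ n ω).trans ((min_le_left _ _).trans (min_le_right _ _)))
    (hoc n _ (hρ n) fun ω => (hρτ n ω).trans (min_le_right _ _))
  obtain ⟨hg, hg'⟩ := hy.integral_gap a b hσ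
  have hgap : ∀ᵐ ω ∂P, 0 ≤ y ω b (min (exitTime y a b K ω) t) -
      y ω a (min (exitTime y a b K ω) t) :=
    hy.monotone.mono fun ω h => sub_nonneg.2 (h a b hab _)
  have hVnn : ∀ᵐ ω ∂P, ((∀ t, 0 ≤ Va t ω) ∧ ∀ t, 0 ≤ Vb t ω) := by
    filter_upwards [hVa', hVb', hVa.zero, hVb.zero] with ω h1 h2 h3 h4
    exact ⟨(quadraticVariation_nonneg_mono h3 h1).1, (quadraticVariation_nonneg_mono h4 h2).1⟩
  -- Markov's inequality for the gap, a true martingale: no localization is needed here, unlike in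
  -- `hS2`.
  have hS1 : P {ω | K ≤ y ω b (min (exitTime y a b K ω) t) -
      y ω a (min (exitTime y a b K ω) t)} ≤ ENNReal.ofReal ((b - a) / K) := by
    have h := mul_meas_ge_le_integral_of_nonneg hgap hg K
    rw [hg'] at h
    rw [← ofReal_measureReal]
    exact ENNReal.ofReal_le_ofReal (by rwa [le_div_iff₀ hK, mul_comm])
  have hS2 : ∀ n, P {ω | A ≤ Va (ρ n ω) ω + Vb (ρ n ω) ω} ≤ ENNReal.ofReal (K * (b - a) / A) := by
    intro n
    have h := mul_meas_ge_le_integral_of_nonneg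
      (hVnn.mono fun ω h => add_nonneg (h.1 (ρ n ω)) (h.2 (ρ n ω))) (hW n).1 A
    rw [← ofReal_measureReal]
    exact ENNReal.ofReal_le_ofReal (by
      rw [le_div_iff₀ hA, mul_comm]
      exact h.trans (hW n).2)
  rw [ENNReal.ofReal_add (by positivity) (by positivity)]
  refine measure_le_of_eventually_mem (S := fun n =>
    {ω | K ≤ y ω b (min (exitTime y a b K ω) t) - y ω a (min (exitTime y a b K ω) t)} ∪
    {ω | A ≤ Va (ρ n ω) ω + Vb (ρ n ω) ω}) ?_
    fun n => (measure_union_le _ _).trans (add_le_add hS1 (hS2 n))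
  filter_upwards [hta, htb, htc, hVa', hVb', hVnn, hy.monotone] with ω h1 h2 h3 h4 h5 h6 h7
  rintro ⟨hmeet, hlarge⟩
  filter_upwards [h1, h2, h3] with n e1 e2 e3
  have hρn : ρ n ω = min (exitTime y a b K ω) t := by
    simp only [ρ]
    exact capTime_of_top _ _ (by simp [e1, e2, e3])
  -- An exit before `t` without a meeting must be at the level `K`. Otherwise the stopped time is
  -- `t` itself, and `Va + Vb` dominates the quadratic variation of the particle `w`.
  rcases lt_or_ge (exitTime y a b K ω) t with hlt | hge
  · left
    have hcont := ((hy.martingale b).continuous ω).sub ((hy.martingale a).continuous ω)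
    have hmem := hitTime_mem (isClosed_le (hcont.min (continuous_const.sub hcont))
      continuous_const) hlt
    have hne := hmeet _ hlt.le
    have hpos : 0 < y ω b (exitTime y a b K ω) - y ω a (exitTime y a b K ω) :=
      sub_pos.2 (lt_of_le_of_ne (h7 a b hab _) hne)
    rcases min_le_iff.1 (show min (y ω b (exitTime y a b K ω) - y ω a (exitTime y a b K ω))
      (K - (y ω b (exitTime y a b K ω) - y ω a (exitTime y a b K ω))) ≤ 0 from hmem) with h | h
    · exact absurd h (not_le.2 hpos)
    · rw [mem_ofPred_eq, min_eq_left hlt.le]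
      linarith
  · right
    rw [mem_ofPred_eq, hρn, min_eq_right hge]
    rcases hw with rfl | rfl
    · rw [← h4, ENNReal.ofReal_le_ofReal_iff (h6.1 t)] at hlarge
      linarith [h6.2 t]
    · rw [← h5, ENNReal.ofReal_le_ofReal_iff (h6.2 t)] at hlarge
      linarith [h6.1 t]

end Flow

/-! ### The law of the mass near zero, and measurability. -/

section Mass

/-- When `a` and `b` meet, monotonicity squeezes together all particles that started between them.
-/
lemma le_mass_of_meeting {T : ℝ} {f : SkorohodSpace T}
    (hf : ∀ u v : I, u < v → ∀ t : Time T, f u t ≤ f v t) {a b w : I} (hab : a < b)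
    (hw : w = a ∨ w = b) {t : Time T} (h : ∃ s ≤ t, f a s = f b s) :
    ENNReal.ofReal (b - a) ≤ mass f w t := by
  obtain ⟨s, hs, hst⟩ := h
  have hmono : ∀ {u v : I}, u ≤ v → f u s ≤ f v s := fun {u v} huv => by
    rcases huv.eq_or_lt with rfl | h
    · exact le_rfl
    · exact hf _ _ h s
  rw [← unitInterval.volume_Icc a b]
  refine measure_mono fun v hv => ⟨s, hs, ?_⟩
  have h1 := hmono hv.1
  have h2 := hmono hv.2
  rcases hw with rfl | rfl <;> linarith

/-- An order-convex set differs from this countable union at most by its least and its greatest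
element. Membership of countably many points thus determines the volume. -/
lemma volume_eq_iUnion_Icc_denseSeq {S : Set I} (hS : S.OrdConnected) :
    volume S = volume (⋃ i, ⋃ j, {v | (TopologicalSpace.denseSeq I i ∈ S ∧
      TopologicalSpace.denseSeq I j ∈ S) ∧ v ∈ Icc (TopologicalSpace.denseSeq I i)
        (TopologicalSpace.denseSeq I j)}) := by
  set D := TopologicalSpace.denseSeq I with hD
  set S' := ⋃ i, ⋃ j, {v | (D i ∈ S ∧ D j ∈ S) ∧ v ∈ Icc (D i) (D j)} with hS'
  have hsub : S' ⊆ S := by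
    intro v hv
    simp only [hS', mem_iUnion] at hv
    obtain ⟨i, j, ⟨hi, hj⟩, hv⟩ := hv
    exact hS.out hi hj hv
  have hdiff : S ⊆ S' ∪ ({v | v ∈ S ∧ v ∈ lowerBounds S} ∪ {v | v ∈ S ∧ v ∈ upperBounds S}) := by
    intro v hv
    by_contra hcon
    have h1 : v ∉ S' := fun h => hcon (Or.inl h)
    have h2 : v ∉ lowerBounds S := fun h => hcon (Or.inr (Or.inl ⟨hv, h⟩))
    have h3 : v ∉ upperBounds S := fun h => hcon (Or.inr (Or.inr ⟨hv, h⟩))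
    simp only [mem_lowerBounds, mem_upperBounds, not_forall, not_le] at h2 h3
    obtain ⟨a, ha, hav⟩ := h2
    obtain ⟨b, hb, hvb⟩ := h3
    have hd := TopologicalSpace.denseRange_denseSeq I
    obtain ⟨_, hi, i, rfl⟩ := hd.inter_open_nonempty _ isOpen_Ioo (nonempty_Ioo.2 hav)
    obtain ⟨_, hj, j, rfl⟩ := hd.inter_open_nonempty _ isOpen_Ioo (nonempty_Ioo.2 hvb)
    exact h1 (mem_iUnion.2 ⟨i, mem_iUnion.2 ⟨j, ⟨hS.out ha hv ⟨hi.1.le, hi.2.le⟩,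
      hS.out hv hb ⟨hj.1.le, hj.2.le⟩⟩, hi.2.le, hj.1.le⟩⟩)
  refine le_antisymm ?_ (measure_mono hsub)
  have hl : volume {v | v ∈ S ∧ v ∈ lowerBounds S} = 0 :=
    Set.Subsingleton.measure_zero (fun a ha b hb => le_antisymm (ha.2 hb.1) (hb.2 ha.1)) _
  have hu : volume {v | v ∈ S ∧ v ∈ upperBounds S} = 0 :=
    Set.Subsingleton.measure_zero (fun a ha b hb => le_antisymm (hb.2 ha.1) (ha.2 hb.1)) _
  calc volume S ≤ volume S' + (volume {v | v ∈ S ∧ v ∈ lowerBounds S} +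
        volume {v | v ∈ S ∧ v ∈ upperBounds S}) :=
        (measure_mono hdiff).trans ((measure_union_le _ _).trans
          (add_le_add le_rfl (measure_union_le _ _)))
    _ = volume S' := by rw [hl, hu, add_zero, add_zero]

/-- A particle between `u` and a member of the cluster is caught by the meeting of those two; the
sides left and right of `u` may use different times. -/
lemma ordConnected_cluster {T : ℝ} {f : SkorohodSpace T}
    (hf : ∀ u v : I, u < v → ∀ t : Time T, f u t ≤ f v t) (u : I) (t : Time T) :
    {v : I | ∃ s : Time T, s ≤ t ∧ f v s = f u s}.OrdConnected := by
  have hmono : ∀ (s : Time T) {u v : I}, u ≤ v → f u s ≤ f v s := fun s u v huv => by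
    rcases huv.eq_or_lt with rfl | h
    · exact le_rfl
    · exact hf _ _ h s
  refine ⟨?_⟩
  rintro a ⟨s, hs, ha⟩ b ⟨r, hr, hb⟩ v ⟨hav, hvb⟩
  rcases le_total v u with h | h
  · exact ⟨s, hs, le_antisymm (hmono s h) (ha ▸ hmono s hav)⟩
  · exact ⟨r, hr, le_antisymm (hb ▸ hmono r hvb) (hmono r h)⟩

variable {Ω : Type*} {mΩ : MeasurableSpace Ω} {T : ℝ} [hT : Fact (0 ≤ T)] {P : Measure Ω}
  [IsProbabilityMeasure P] {y : Ω → SkorohodSpace T}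

/-- Small masses are unlikely. -/
theorem IsFlow.measure_mass_lt_le (hy : IsFlow y P) (u : I) {t : Time T} (ht : 0 < (t : ℝ)) {r : ℝ}
    (hr : 0 < r) (hr' : r ≤ 1 / 2) :
    P {ω | mass (y ω) u t < ENNReal.ofReal r} ≤
      ENNReal.ofReal (2 * (r * Real.sqrt r) / Real.sqrt t) := by
  -- The partner of `u` goes to the side that has room in [0, 1]; this uses `r ≤ 1/2`.
  obtain ⟨a, b, hba, hw⟩ : ∃ a b : I, (b : ℝ) - a = r ∧ (u = a ∨ u = b) := by
    rcases le_total ((u : ℝ) + r) 1 with h | h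
    · exact ⟨u, ⟨u + r, by linarith [u.2.1], h⟩, by simp, Or.inl rfl⟩
    · exact ⟨⟨u - r, by linarith, by linarith [u.2.2]⟩, u, by simp, Or.inr rfl⟩
  have hab : a < b := Subtype.coe_lt_coe.1 (sub_pos.1 (hba.symm ▸ hr))
  have hst : 0 < Real.sqrt t := Real.sqrt_pos.2 ht
  have hsr : 0 < Real.sqrt r := Real.sqrt_pos.2 hr
  -- The level `A` is the quadratic variation forced by a mass below `r`; this `K` makes the two
  -- terms r/K and K r/A equal.
  have key := hy.measure_not_meeting_le hab hw t (A := t / r) (K := Real.sqrt t / Real.sqrt r)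
    (by positivity) (by positivity)
  rw [hba] at key
  have hval : r / (Real.sqrt t / Real.sqrt r) + Real.sqrt t / Real.sqrt r * r / (t / r) =
      2 * (r * Real.sqrt r) / Real.sqrt t := by
    have h1 := Real.sq_sqrt ht.le
    have h2 := Real.sq_sqrt hr.le
    generalize Real.sqrt t = x at *
    generalize Real.sqrt r = z at *
    rw [← h1, ← h2]
    field_simp
    ring
  rw [← hval]
  refine le_trans (measure_mono_ae ?_) key
  filter_upwards [hy.monotone] with ω hm hlt
  refine ⟨fun s hs hmeet => ?_, ofReal_le_inverseMassIntegral_of_mass_le hr (le_of_lt hlt)⟩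
  have := le_mass_of_meeting hm hab hw ⟨s, hs, hmeet⟩
  rw [hba] at this
  exact absurd hlt (not_lt.2 this)

/-- Almost surely the cluster is order-convex, so its volume is that of a section of a countable
union of measurable rectangles. -/
lemma IsFlow.aemeasurable_mass {P : Measure Ω} (hy : IsFlow y P) (u : I) (t : Time T) :
    AEMeasurable (fun ω => mass (y ω) u t) P := by
  set D := TopologicalSpace.denseSeq I with hD
  let A : ℕ → Set Ω := fun i => {ω | ∃ s : Time T, s ≤ t ∧ y ω (D i) s = y ω u s}
  have hA : ∀ i, MeasurableSet (A i) := by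
    intro i
    have h := measurableSet_exists_nonpos (Z := fun s ω => |y ω (D i) s - y ω u s|)
      (fun ω => (((hy.martingale (D i)).continuous ω).sub ((hy.martingale u).continuous ω)).abs) t
      (fun s _ => continuous_abs.measurable.comp
        (((measurable_eval (D i) s).comp hy.measurable).sub
          ((measurable_eval u s).comp hy.measurable)))
    simpa only [abs_nonpos_iff, sub_eq_zero] using h
  let B : Set (Ω × I) := ⋃ i, ⋃ j, (A i ∩ A j) ×ˢ Icc (D i) (D j)
  have hB : MeasurableSet B := MeasurableSet.iUnion fun i => MeasurableSet.iUnion fun j =>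
    ((hA i).inter (hA j)).prod measurableSet_Icc
  refine ⟨_, measurable_measure_prodMk_left (ν := (volume : Measure I)) hB, ?_⟩
  filter_upwards [hy.monotone] with ω hm
  rw [mass, volume_eq_iUnion_Icc_denseSeq (ordConnected_cluster hm u t)]
  congr 1
  ext v
  simp only [B, A, mem_iUnion, mem_preimage, mem_prod, mem_inter_iff, mem_ofPred_eq, hD]

/-- Measurability is inherited from the adapted version `V`, without joint measurability of the mass
in time and ω. -/
lemma IsFlow.aemeasurable_inverseMassIntegral {P : Measure Ω} (hy : IsFlow y P) (u : I)
    (t : Time T) :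
    AEMeasurable (fun ω => inverseMassIntegral (y ω) u t) P := by
  obtain ⟨V, hV, hV'⟩ := hy.quadraticVariation u
  exact ⟨_, ((hV.adapted t).mono (Filtration.le _ t)).measurable.ennreal_ofReal,
    hV'.mono fun ω h => (h t).symm⟩

end Mass

/-! ### Negative moments of the mass. -/

section Moments

/-- If 2^{-(k+2)} ≤ x < 2^{-(k+1)}, the term of index k suffices; if x ≥ 1/2, the constant does. At
x = 0 every term is at least 1, so the series diverges. -/
lemma ennreal_rpow_neg_le_tsum {β : ℝ} (hβ : 0 < β) (x : ℝ≥0∞) :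
    x ^ (-β) ≤ (2 : ℝ≥0∞) ^ β + ∑' k : ℕ, {z : ℝ≥0∞ | z < 2⁻¹ ^ (k + 1)}.indicator
      (fun _ => ((2 : ℝ≥0∞) ^ β) ^ (k + 2)) x := by
  have hpow : ∀ n : ℕ, 2⁻¹ ^ n ≤ x → x ^ (-β) ≤ ((2 : ℝ≥0∞) ^ β) ^ n := by
    intro n hn
    rw [ENNReal.rpow_neg]
    refine (ENNReal.inv_le_inv.2 (ENNReal.rpow_le_rpow hn hβ.le)).trans_eq ?_
    rw [← ENNReal.inv_pow, ENNReal.inv_rpow, inv_inv, ← ENNReal.rpow_natCast,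
      ← ENNReal.rpow_natCast, ← ENNReal.rpow_mul, ← ENNReal.rpow_mul, mul_comm]
  have hone : (1 : ℝ≥0∞) ≤ 2 ^ β := ENNReal.one_le_rpow one_le_two hβ
  rcases eq_or_ne x 0 with rfl | hx
  · have : ∀ k : ℕ, (1 : ℝ≥0∞) ≤ {z : ℝ≥0∞ | z < 2⁻¹ ^ (k + 1)}.indicator
      (fun _ => ((2 : ℝ≥0∞) ^ β) ^ (k + 2)) 0 := by
      intro k
      rw [indicator_of_mem]
      · exact one_le_pow₀ hone
      · exact ENNReal.pow_pos (by simp) _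
    refine le_top.trans (le_trans ?_ le_add_self)
    refine le_trans ?_ (ENNReal.tsum_le_tsum this)
    rw [ENNReal.tsum_const_eq_top_of_ne_zero one_ne_zero]
  rcases le_or_gt (2⁻¹ : ℝ≥0∞) x with h | h
  · exact ((hpow 1 (by simpa using h)).trans_eq (pow_one _)).trans le_self_add
  · have hex : ∃ n : ℕ, 2⁻¹ ^ (n + 2) ≤ x := by
      obtain ⟨n, hn⟩ := ENNReal.exists_inv_two_pow_lt hx
      exact ⟨n, (pow_le_pow_right_of_le_one' (ENNReal.inv_le_one.2 one_le_two) (by omega)).trans hn.le⟩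
    classical
    have hlt : x < 2⁻¹ ^ (Nat.find hex + 1) := by
      rcases Nat.eq_zero_or_eq_succ_pred (Nat.find hex) with h0 | h0
      · rw [h0]; simpa using h
      · have := Nat.find_min hex (m := (Nat.find hex).pred) (by omega)
        rw [h0]
        exact not_le.1 this
    refine (hpow _ (Nat.find_spec hex)).trans (le_trans ?_ le_add_self)
    refine le_trans ?_ (ENNReal.le_tsum (Nat.find hex))
    rw [indicator_of_mem (show x ∈ {z : ℝ≥0∞ | z < 2⁻¹ ^ (Nat.find hex + 1)} from hlt)]

/-- The left side is 2^{β - 3/2}, the ratio of the geometric series for the moment of order β; this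
is where the threshold 3/2 enters. -/
lemma two_rpow_mul_lt_one {β : ℝ} (hβ' : β < 3 / 2) :
    (2 : ℝ≥0∞) ^ β * ENNReal.ofReal (1 / 2 * Real.sqrt (1 / 2)) < 1 := by
  have h2 : (2 : ℝ≥0∞) = ENNReal.ofReal 2 := by simp
  rw [h2, ENNReal.ofReal_rpow_of_pos two_pos, ← ENNReal.ofReal_mul (by positivity),
    ← ENNReal.ofReal_one, ENNReal.ofReal_lt_ofReal_iff one_pos]
  have h3 : (1 : ℝ) / 2 * Real.sqrt (1 / 2) = 2 ^ (-(3 / 2) : ℝ) := by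
    rw [Real.sqrt_eq_rpow, show (1 : ℝ) / 2 = 2 ^ (-1 : ℝ) by rw [Real.rpow_neg_one]; norm_num,
      ← Real.rpow_mul two_pos.le, ← Real.rpow_add two_pos]
    norm_num
  rw [h3, ← Real.rpow_add two_pos]
  exact Real.rpow_lt_one_of_one_lt_of_neg one_lt_two (by linarith)

lemma sqrt_pow_eq {x : ℝ} (hx : 0 ≤ x) (n : ℕ) : Real.sqrt (x ^ n) = Real.sqrt x ^ n := by
  rw [Real.sqrt_eq_iff_mul_self_eq (by positivity) (by positivity), ← mul_pow,
    Real.mul_self_sqrt hx]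

variable {Ω : Type*} {mΩ : MeasurableSpace Ω} {T : ℝ} [hT : Fact (0 ≤ T)] {P : Measure Ω}
  [IsProbabilityMeasure P] {y : Ω → SkorohodSpace T}

lemma IsFlow.measure_mass_lt_pow_le (hy : IsFlow y P) (u : I) {t : Time T} (ht : 0 < (t : ℝ))
    (k : ℕ) : P {ω | mass (y ω) u t < 2⁻¹ ^ (k + 1)} ≤
      ENNReal.ofReal (2 / Real.sqrt t) * ENNReal.ofReal (1 / 2 * Real.sqrt (1 / 2)) ^ (k + 1) := by
  have hr : (0 : ℝ) < (1 / 2) ^ (k + 1) := by positivity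
  have hr' : ((1 : ℝ) / 2) ^ (k + 1) ≤ 1 / 2 := by
    rw [pow_succ]
    exact mul_le_of_le_one_left (by norm_num) (pow_le_one₀ (by norm_num) (by norm_num))
  have hof : ENNReal.ofReal ((1 / 2) ^ (k + 1)) = 2⁻¹ ^ (k + 1) := by
    rw [ENNReal.ofReal_pow (by norm_num), one_div, ENNReal.ofReal_inv_of_pos two_pos]
    simp
  have h := hy.measure_mass_lt_le u ht hr hr'
  rw [hof] at h
  refine h.trans_eq ?_
  rw [← ENNReal.ofReal_pow (by positivity), ← ENNReal.ofReal_mul (by positivity),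
    sqrt_pow_eq (by norm_num), ← mul_pow]
  congr 1
  ring

/-- Negative moments of the mass. -/
theorem IsFlow.exists_lintegral_mass_rpow_le (hy : IsFlow y P) {β : ℝ} (hβ : 0 < β)
    (hβ' : β < 3 / 2) : ∃ C : ℝ, 0 ≤ C ∧ ∀ (u : I) (t : Time T), 0 < (t : ℝ) →
      ∫⁻ ω, (mass (y ω) u t) ^ (-β) ∂P ≤ ENNReal.ofReal (C / Real.sqrt t) := by
  set p : ℝ≥0∞ := ENNReal.ofReal (1 / 2 * Real.sqrt (1 / 2)) with hp
  set b : ℝ≥0∞ := (2 : ℝ≥0∞) ^ β with hb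
  have hq : b * p < 1 := two_rpow_mul_lt_one hβ'
  have hbtop : b ≠ ∞ := ENNReal.rpow_ne_top_of_nonneg hβ.le ENNReal.ofNat_ne_top
  set D : ℝ≥0∞ := b * (b * p * (1 - b * p)⁻¹) with hD
  have hDtop : D ≠ ∞ := ENNReal.mul_ne_top hbtop (ENNReal.mul_ne_top hq.ne_top
    (ENNReal.inv_ne_top.2 (tsub_pos_of_lt hq).ne'))
  -- The series contributes 2D/√t; the constant `b` is absorbed through √t ≤ √T.
  refine ⟨b.toReal * Real.sqrt T + 2 * D.toReal, by positivity, fun u t ht => ?_⟩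
  have hst : 0 < Real.sqrt t := Real.sqrt_pos.2 ht
  have hm : ∀ k : ℕ, NullMeasurableSet {ω | mass (y ω) u t < 2⁻¹ ^ (k + 1)} P := fun k =>
    nullMeasurableSet_lt (hy.aemeasurable_mass u t) aemeasurable_const
  calc ∫⁻ ω, (mass (y ω) u t) ^ (-β) ∂P
      ≤ ∫⁻ ω, (b + ∑' k : ℕ, {ω | mass (y ω) u t < 2⁻¹ ^ (k + 1)}.indicator
          (fun _ => b ^ (k + 2)) ω) ∂P := lintegral_mono fun ω => ennreal_rpow_neg_le_tsum hβ _
    _ = b + ∑' k : ℕ, b ^ (k + 2) * P {ω | mass (y ω) u t < 2⁻¹ ^ (k + 1)} := by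
        rw [lintegral_add_left measurable_const, lintegral_const, measure_univ, mul_one,
          lintegral_tsum fun k => aemeasurable_const.indicator₀ (hm k)]
        simp_rw [lintegral_indicator_const₀ (hm _)]
    _ ≤ b + ∑' k : ℕ, ENNReal.ofReal (2 / Real.sqrt t) * (b * (b * p * (b * p) ^ k)) := by
        refine add_le_add le_rfl (ENNReal.tsum_le_tsum fun k => ?_)
        refine (mul_le_mul_right (hy.measure_mass_lt_pow_le u ht k) _).trans_eq ?_
        rw [← hp]
        ring
    _ = b + ENNReal.ofReal (2 / Real.sqrt t) * D := by
        rw [ENNReal.tsum_mul_left, ENNReal.tsum_mul_left, ENNReal.tsum_mul_left,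
          ENNReal.tsum_geometric]
    _ ≤ ENNReal.ofReal ((b.toReal * Real.sqrt T + 2 * D.toReal) / Real.sqrt t) := by
        rw [← ENNReal.ofReal_toReal hbtop, ← ENNReal.ofReal_toReal hDtop,
          ← ENNReal.ofReal_mul (by positivity), ← ENNReal.ofReal_add (by positivity)
          (by positivity), ENNReal.toReal_ofReal ENNReal.toReal_nonneg,
          ENNReal.toReal_ofReal ENNReal.toReal_nonneg]
        refine ENNReal.ofReal_le_ofReal ?_
        rw [add_div, div_mul_eq_mul_div]
        refine add_le_add ?_ le_rfl
        rw [le_div_iff₀ hst]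
        exact mul_le_mul_of_nonneg_left (Real.sqrt_le_sqrt t.2.2) ENNReal.toReal_nonneg

/-! ### Expected quadratic variation and variance of a particle. -/

/-- The time `t / 2 ^ k`. -/
noncomputable def halvedTime {T : ℝ} (t : Time T) (k : ℕ) : Time T :=
  ⟨(t : ℝ) * (1 / 2) ^ k, mul_nonneg t.2.1 (by positivity),
    (mul_le_of_le_one_right t.2.1 (pow_le_one₀ (by norm_num) (by norm_num))).trans t.2.2⟩

lemma Iic_subset_iUnion_halvedTime (t : Time T) :
    Iic t ⊆ Iic ⊥ ∪ ⋃ k, Ioc (halvedTime t (k + 1)) (halvedTime t k) := by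
  intro s hs
  rcases eq_or_lt_of_le (bot_le : ⊥ ≤ s) with h | h
  · exact Or.inl h.ge
  · right
    have hs0 : (0 : ℝ) < s := h
    have ht0 : (0 : ℝ) < t := hs0.trans_le hs
    obtain ⟨n, hn1, hn2⟩ := exists_nat_pow_near_of_lt_one (x := (s : ℝ) / t) (y := 1 / 2)
      (by positivity) ((div_le_one ht0).2 hs) (by norm_num) (by norm_num)
    rw [lt_div_iff₀ ht0, mul_comm] at hn1
    rw [div_le_iff₀ ht0, mul_comm] at hn2
    exact mem_iUnion.2 ⟨n, hn1, hn2⟩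

/-- The inverse mass decreases in time, so on each dyadic interval it is at most its value at the
left endpoint. The countable sum can be integrated over ω with measurability at fixed times only. -/
lemma inverseMassIntegral_le_tsum (f : SkorohodSpace T) (u : I) (t : Time T) :
    inverseMassIntegral f u t ≤
      ∑' k, (mass f u (halvedTime t (k + 1))) ^ (-1 : ℝ) * ENNReal.ofReal (halvedTime t k) := by
  have h0 : ∫⁻ s in Iic ⊥, (mass f u s)⁻¹ ∂lebesgueTime T = 0 := by
    refine setLIntegral_measure_zero _ _ ?_
    rw [lebesgueTime_Iic]
    exact ENNReal.ofReal_zero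
  calc inverseMassIntegral f u t
      ≤ ∫⁻ s in Iic ⊥ ∪ ⋃ k, Ioc (halvedTime t (k + 1)) (halvedTime t k), (mass f u s)⁻¹
          ∂lebesgueTime T := lintegral_mono_set (Iic_subset_iUnion_halvedTime t)
    _ ≤ ∑' k, ∫⁻ s in Ioc (halvedTime t (k + 1)) (halvedTime t k), (mass f u s)⁻¹
          ∂lebesgueTime T := by
        refine (lintegral_union_le _ _ _).trans ?_
        rw [h0, zero_add]
        exact lintegral_iUnion_le _ _
    _ ≤ _ := by
        refine ENNReal.tsum_le_tsum fun k => ?_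
        rw [ENNReal.rpow_neg_one, ← lebesgueTime_Iic]
        calc ∫⁻ s in Ioc (halvedTime t (k + 1)) (halvedTime t k), (mass f u s)⁻¹ ∂lebesgueTime T
            ≤ ∫⁻ _ in Ioc (halvedTime t (k + 1)) (halvedTime t k),
                (mass f u (halvedTime t (k + 1)))⁻¹ ∂lebesgueTime T := by
              refine setLIntegral_mono' measurableSet_Ioc fun s hs => ENNReal.inv_le_inv.2 ?_
              exact measure_mono fun v ⟨r, hr, hv⟩ => ⟨r, hr.trans hs.1.le, hv⟩
          _ ≤ _ := by
              rw [setLIntegral_const]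
              exact mul_le_mul_right (measure_mono Ioc_subset_Iic_self) _

/-- The expected quadratic variation of a particle is of order at most `√t`. -/
theorem IsFlow.exists_lintegral_inverseMassIntegral_le (hy : IsFlow y P) :
    ∃ C : ℝ, 0 ≤ C ∧ ∀ (u : I) (t : Time T),
      ∫⁻ ω, inverseMassIntegral (y ω) u t ∂P ≤ ENNReal.ofReal (C * Real.sqrt t) := by
  obtain ⟨C, hC, h⟩ := hy.exists_lintegral_mass_rpow_le one_pos (by norm_num)
  -- The bound C/√(t q^{2(k+1)}) times t q^{2k} is (C/q) √t q^k, a geometric series of ratio `q`.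
  set q : ℝ := Real.sqrt (1 / 2) with hq
  have hq0 : 0 < q := Real.sqrt_pos.2 (by norm_num)
  have hq1 : q < 1 := by
    rw [hq, Real.sqrt_lt' one_pos]
    norm_num
  have hqq : q * q = 1 / 2 := Real.mul_self_sqrt (by norm_num)
  refine ⟨C / q * (1 - q)⁻¹, by have := sub_pos.2 hq1; positivity, fun u t => ?_⟩
  rcases eq_or_lt_of_le t.2.1 with ht | ht
  · refine (lintegral_mono fun ω => inverseMassIntegral_le_tsum (y ω) u t).trans ?_
    have : ∀ k, ENNReal.ofReal (halvedTime t k) = 0 := fun k => by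
      simp [halvedTime, ← ht]
    simp [this]
  have hst : 0 < Real.sqrt t := Real.sqrt_pos.2 ht
  calc ∫⁻ ω, inverseMassIntegral (y ω) u t ∂P
      ≤ ∫⁻ ω, ∑' k, (mass (y ω) u (halvedTime t (k + 1))) ^ (-1 : ℝ) *
          ENNReal.ofReal (halvedTime t k) ∂P :=
        lintegral_mono fun ω => inverseMassIntegral_le_tsum (y ω) u t
    _ = ∑' k, (∫⁻ ω, (mass (y ω) u (halvedTime t (k + 1))) ^ (-1 : ℝ) ∂P) *
          ENNReal.ofReal (halvedTime t k) := by
        have hm := fun k => (hy.aemeasurable_mass u (halvedTime t (k + 1))).pow_const (-1 : ℝ)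
        rw [lintegral_tsum fun k => (hm k).mul_const _]
        simp_rw [fun k => lintegral_mul_const'' (ENNReal.ofReal (halvedTime t k)) (hm k)]
    _ ≤ ∑' k : ℕ, ENNReal.ofReal (C / q * Real.sqrt t * q ^ k) := by
        refine ENNReal.tsum_le_tsum fun k => ?_
        have hpos : 0 < ((halvedTime t (k + 1) : Time T) : ℝ) := by
          simp only [halvedTime]; positivity
        refine (mul_le_mul_left (h u _ hpos) _).trans_eq ?_
        rw [← ENNReal.ofReal_mul (by positivity)]
        congr 1
        simp only [halvedTime]
        rw [Real.sqrt_mul ht.le, sqrt_pow_eq (by norm_num), ← hq, ← hqq, mul_pow, pow_succ]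
        have h1 := Real.sq_sqrt ht.le
        generalize Real.sqrt t = x at *
        rw [← h1]
        field_simp
    _ = ENNReal.ofReal (C / q * (1 - q)⁻¹ * Real.sqrt t) := by
        have hsum := summable_geometric_of_lt_one hq0.le hq1
        rw [← ENNReal.ofReal_tsum_of_nonneg (fun k => by positivity) (hsum.mul_left _),
          tsum_mul_left, tsum_geometric_of_lt_one hq0.le hq1]
        congr 1
        ring

/-- The second moment of a particle is bounded by the expected quadratic variation. -/
theorem IsFlow.lintegral_sq_le (hy : IsFlow y P) (u : I) (t : Time T)
    (hfin : ∫⁻ ω, inverseMassIntegral (y ω) u t ∂P ≠ ∞) :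
    ∫⁻ ω, ENNReal.ofReal ((y ω u t - (u : ℝ)) ^ 2) ∂P ≤
      ∫⁻ ω, inverseMassIntegral (y ω) u t ∂P := by
  obtain ⟨V, hV, hV'⟩ := hy.quadraticVariation u
  obtain ⟨τ, hτ, hτt, ho⟩ := hy.exists_localizing u u hV
  have hVm : ∀ᵐ ω ∂P, (∀ t, 0 ≤ V t ω) ∧ Monotone fun t => V t ω := by
    filter_upwards [hV', hV.zero] with ω h1 h2
    exact quadraticVariation_nonneg_mono h2 h1
  have hlint : ∫⁻ ω, inverseMassIntegral (y ω) u t ∂P = ∫⁻ ω, ENNReal.ofReal (V t ω) ∂P :=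
    lintegral_congr_ae (hV'.mono fun ω h => (h t).symm)
  have hVt : Integrable (V t) P := by
    refine ⟨((hV.adapted t).mono (Filtration.le _ t)).aestronglyMeasurable, ?_⟩
    rw [hasFiniteIntegral_iff_ofReal (hVm.mono fun ω h => h.1 t), ← hlint]
    exact hfin.lt_top
  let ρ : ℕ → Ω → Time T := fun n => capTime (fun _ => t) (τ n)
  have hρ := fun n => isStopping_capTime (isStopping_const
    (completion (flowFiltration y hy.measurable) P) t) (hτ n)
  have hbound : ∀ n, AEMeasurable (fun ω => ENNReal.ofReal ((y ω u (ρ n ω) - (u : ℝ)) ^ 2)) P ∧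
      ∫⁻ ω, ENNReal.ofReal ((y ω u (ρ n ω) - (u : ℝ)) ^ 2) ∂P ≤
        ∫⁻ ω, inverseMassIntegral (y ω) u t ∂P := by
    intro n
    obtain ⟨hX, hX'⟩ := ho n (ρ n) (hρ n) fun ω => capTime_le_right _ _ ω
    obtain ⟨hY, hY'⟩ := hy.integral_stopped u (hρ n)
    -- Localization only makes the difference of y² and `V` integrable; the bound of `V` at the
    -- stopped time by `V t` allows the two to be separated.
    have hVρ : Integrable (fun ω => V (ρ n ω) ω) P := by
      refine hVt.mono' ?_ ?_
      · have := (hY.aestronglyMeasurable.mul hY.aestronglyMeasurable).sub hX.aestronglyMeasurable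
        refine this.congr (ae_of_all _ fun ω => ?_)
        exact sub_sub_cancel (y ω u (ρ n ω) * y ω u (ρ n ω)) (V (ρ n ω) ω)
      · filter_upwards [hVm] with ω h
        rw [Real.norm_of_nonneg (h.1 _)]
        exact h.2 (capTime_le_left _ _ ω)
    have hXV : Integrable (fun ω => (y ω u (ρ n ω) * y ω u (ρ n ω) - V (ρ n ω) ω) +
        V (ρ n ω) ω) P := hX.add hVρ
    have hYc : Integrable (fun ω => 2 * (u : ℝ) * y ω u (ρ n ω) - (u : ℝ) ^ 2) P :=
      (hY.const_mul _).sub (integrable_const _)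
    have heq : (fun ω => (y ω u (ρ n ω) - (u : ℝ)) ^ 2) = fun ω =>
        (y ω u (ρ n ω) * y ω u (ρ n ω) - V (ρ n ω) ω) + V (ρ n ω) ω -
          (2 * (u : ℝ) * y ω u (ρ n ω) - (u : ℝ) ^ 2) := by
      ext ω
      ring
    have hsq : Integrable (fun ω => (y ω u (ρ n ω) - (u : ℝ)) ^ 2) P := by
      rw [heq]
      exact hXV.sub hYc
    have hval : ∫ ω, (y ω u (ρ n ω) - (u : ℝ)) ^ 2 ∂P = ∫ ω, V (ρ n ω) ω ∂P := by
      rw [heq, integral_sub hXV hYc, integral_add hX hVρ,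
        integral_sub (hY.const_mul _) (integrable_const _), integral_const_mul, hX', hY',
        integral_const, probReal_univ, one_smul]
      ring
    refine ⟨hsq.aestronglyMeasurable.aemeasurable.ennreal_ofReal, ?_⟩
    rw [← ofReal_integral_eq_lintegral_ofReal hsq (ae_of_all _ fun ω => sq_nonneg _), hval, hlint,
      ← ofReal_integral_eq_lintegral_ofReal hVt (hVm.mono fun ω h => h.1 t)]
    refine ENNReal.ofReal_le_ofReal (integral_mono_ae hVρ hVt ?_)
    filter_upwards [hVm] with ω h
    exact h.2 (capTime_le_left _ _ ω)
  -- The stopped times are eventually equal to `t`, so Fatou's lemma applies to a sequence that is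
  -- eventually constant at almost every ω.
  calc ∫⁻ ω, ENNReal.ofReal ((y ω u t - (u : ℝ)) ^ 2) ∂P
      = ∫⁻ ω, liminf (fun n => ENNReal.ofReal ((y ω u (ρ n ω) - (u : ℝ)) ^ 2)) atTop ∂P := by
        refine lintegral_congr_ae ?_
        filter_upwards [hτt] with ω h
        refine (Tendsto.liminf_eq (tendsto_const_nhds.congr' ?_)).symm
        filter_upwards [h] with n hn
        simp only [ρ, capTime_of_top _ _ hn]
    _ ≤ liminf (fun n => ∫⁻ ω, ENNReal.ofReal ((y ω u (ρ n ω) - (u : ℝ)) ^ 2) ∂P) atTop :=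
        lintegral_liminf_le' fun n => (hbound n).1
    _ ≤ ∫⁻ ω, inverseMassIntegral (y ω) u t ∂P := by
        refine (liminf_le_liminf (Eventually.of_forall fun n => (hbound n).2)).trans_eq ?_
        exact tendsto_const_nhds.liminf_eq

/-- The variance of a particle is of order at most `√t`. -/
theorem IsFlow.exists_integral_sq_le (hy : IsFlow y P) :
    ∃ C : ℝ, ∀ (u : I) (t : Time T), Integrable (fun ω => (y ω u t - (u : ℝ)) ^ 2) P ∧
      ∫ ω, (y ω u t - (u : ℝ)) ^ 2 ∂P ≤ C * Real.sqrt t := by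
  obtain ⟨C, hC, h⟩ := hy.exists_lintegral_inverseMassIntegral_le
  refine ⟨C, fun u t => ?_⟩
  have hle := (hy.lintegral_sq_le u t ((h u t).trans_lt ENNReal.ofReal_lt_top).ne).trans (h u t)
  have hm : AEStronglyMeasurable (fun ω => (y ω u t - (u : ℝ)) ^ 2) P :=
    ((((hy.martingale u).martingale.integrable t).aestronglyMeasurable).sub
      aestronglyMeasurable_const).pow 2
  have hint : Integrable (fun ω => (y ω u t - (u : ℝ)) ^ 2) P := by
    refine ⟨hm, ?_⟩
    rw [hasFiniteIntegral_iff_ofReal (ae_of_all _ fun ω => sq_nonneg _)]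
    exact hle.trans_lt ENNReal.ofReal_lt_top
  refine ⟨hint, ?_⟩
  rw [← ofReal_integral_eq_lintegral_ofReal hint (ae_of_all _ fun ω => sq_nonneg _)] at hle
  exact (ENNReal.ofReal_le_ofReal_iff (by positivity)).1 hle

theorem IsFlow.isContinuousSqIntegrableMartingale (hy : IsFlow y P) (u : I) :
    IsContinuousSqIntegrableMartingale (fun t ω => y ω u t)
      (flowFiltration y hy.measurable) P := by
  refine ⟨hy.martingale u, fun t => ?_⟩
  obtain ⟨C, hC⟩ := hy.exists_integral_sq_le
  have hm := ((hy.martingale u).martingale.integrable t).aestronglyMeasurable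
  have h1 : MemLp (fun ω => y ω u t - (u : ℝ)) 2 P :=
    (memLp_two_iff_integrable_sq (hm.sub aestronglyMeasurable_const)).2 (hC u t).1
  refine (h1.add (memLp_const (u : ℝ))).ae_eq (ae_of_all _ fun ω => ?_)
  exact sub_add_cancel (y ω u t) (u : ℝ)

end Moments

end HeavyFlow

theorem mainTheorem5 {T : ℝ} [Fact (0 ≤ T)] {Ω : Type*} {mΩ : MeasurableSpace Ω}
    (P : Measure Ω) [IsProbabilityMeasure P] (y : Ω → HeavyFlow.SkorohodSpace T)
    (hy : HeavyFlow.IsFlow y P) :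
    (∀ β : ℝ, 0 < β → β < 3 / 2 → ∃ C : ℝ, ∀ (u : I) (t : HeavyFlow.Time T), 0 < (t : ℝ) →
      AEMeasurable (fun ω => HeavyFlow.mass (y ω) u t) P ∧
      ∫⁻ ω, (HeavyFlow.mass (y ω) u t) ^ (-β) ∂P ≤ ENNReal.ofReal (C / Real.sqrt t)) ∧
    (∃ C : ℝ, ∀ (u : I) (t : HeavyFlow.Time T),
      AEMeasurable (fun ω => HeavyFlow.inverseMassIntegral (y ω) u t) P ∧
      ∫⁻ ω, HeavyFlow.inverseMassIntegral (y ω) u t ∂P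
        ≤ ENNReal.ofReal (C * Real.sqrt t)) ∧
    (∃ C : ℝ, ∀ (u : I) (t : HeavyFlow.Time T),
      Integrable (fun ω => (y ω u t - (u : ℝ)) ^ 2) P ∧
      ∫ ω, (y ω u t - (u : ℝ)) ^ 2 ∂P ≤ C * Real.sqrt t) ∧
    (∀ u : I, HeavyFlow.IsContinuousSqIntegrableMartingale (fun t ω => y ω u t)
      (HeavyFlow.flowFiltration y hy.measurable) P) := by
  refine ⟨fun β hβ hβ' => ?_, ?_, hy.exists_integral_sq_le, hy.isContinuousSqIntegrableMartingale⟩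
  · obtain ⟨C, -, h⟩ := hy.exists_lintegral_mass_rpow_le hβ hβ'
    exact ⟨C, fun u t ht => ⟨hy.aemeasurable_mass u t, h u t ht⟩⟩
  · obtain ⟨C, -, h⟩ := hy.exists_lintegral_inverseMassIntegral_le
    exact ⟨C, fun u t => ⟨hy.aemeasurable_inverseMassIntegral u t, h u t⟩⟩
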